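/- Let $\omega>0$, $\kappa>0$ and $\gamma>0$ be constants. Consider the coherently controlled qubit system for the Bloch vector $\mathbf r=(r_x,r_y,r_z)\in\mathbb R^3$, $$\dot{\mathbf r}=\omega f_0(\mathbf r)+2\kappa\, u(t) f_1(\mathbf r),\qquad f_0(\mathbf r)=\begin{pmatrix}-r_y\\ r_x\\ 0\end{pmatrix}-\frac{\gamma}{\omega}\begin{pmatrix}\frac12 r_x\\ \frac12 r_y\\ r_z\end{pmatrix}+\frac{\gamma}{\omega}\begin{pmatrix}0\\0\\1\end{pmatrix},\qquad f_1(\mathbf r)=\begin{pmatrix}0\\-r_z\\ r_y\end{pmatrix}.$$ For $\mathbf r^0\in\mathbb R^3$ let $C_+(\mathbf r^0)$ be the set of all points $\mathbf r(T)$, where $T\ge 0$ and $\mathbf r:[0,T]\to\mathbb R^3$ is an absolutely continuous function that satisfies $\mathbf r(0)=\mathbf r^0$ and solves the system almost everywhere on $[0,T]$ for some control $u\in L^1([0,T];\mathbb R)$. Then for every $\mathbf r^0\in\mathbb R^3$ (in particular, for every $\mathbf r^0$ in the Bloch ball $|\mathbf r^0|\le 1$) $$\operatorname{int}(\operatorname{cl}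 C_+(\mathbf r^0))\subset C_+(\mathbf r^0)\subset \operatorname{cl} C_+(\mathbf r^0)=\operatorname{cl}(\operatorname{int} C_+(\mathbf r^0)),$$ where interiors and closures are taken in $\mathbb R^3$ and $\subset$ denotes not necessarily strict inclusion. -/

import Mathlib

open MeasureTheory Set

/-- The space `ℝ³` of Bloch vectors `r = (r_x, r_y, r_z) = (r 0, r 1, r 2)`. -/
abbrev BlochSpace : Type := EuclideanSpace ℝ (Fin 3)

/-- The drift field
`f₀(r) = (-r_y, r_x, 0) - (γ/ω) (r_x/2, r_y/2, r_z) + (γ/ω) (0, 0, 1)`. -/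
noncomputable def driftField (ω γ : ℝ) (r : BlochSpace) : BlochSpace :=
  !₂[-r 1, r 0, 0] - (γ / ω) • !₂[r 0 / 2, r 1 / 2, r 2] + (γ / ω) • !₂[0, 0, 1]

/-- The field of the coherent control, `f₁(r) = (0, -r_z, r_y)`. -/
noncomputable def controlField (r : BlochSpace) : BlochSpace :=
  !₂[0, -r 2, r 1]

/-- `r` is a trajectory on `[0, T]` of the coherently controlled system
`ṙ = ω f₀(r) + 2 κ f₁(r) u` for the control `u ∈ L¹(0, T)`: it is absolutely continuous on `[0, T]`
and satisfies the equation at almost every `t ∈ [0, T]`. -/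
structure IsCoherentTrajectory (ω κ γ T : ℝ) (u : ℝ → ℝ) (r : ℝ → BlochSpace) : Prop where
  integrable_control : IntervalIntegrable u volume 0 T
  absolutelyContinuous : AbsolutelyContinuousOnInterval r 0 T
  ae_hasDerivAt : ∀ᵐ t ∂(volume.restrict (Icc 0 T)),
    HasDerivAt r (ω • driftField ω γ (r t) + (2 * κ * u t) • controlField (r t)) t

/-- The forward reachable set `C₊(r⁰)` of the coherently controlled system: all end points `r(T)`,
`T ≥ 0`, of its trajectories with `r(0) = r⁰`. -/
def coherentReachableSet (ω κ γ : ℝ) (r₀ : BlochSpace) : Set BlochSpace :=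
  {r₁ | ∃ (T : ℝ) (u : ℝ → ℝ) (r : ℝ → BlochSpace),
    0 ≤ T ∧ IsCoherentTrajectory ω κ γ T u r ∧ r 0 = r₀ ∧ r T = r₁}

/-! The argument is Krener's, applied to an arbitrary set `C` invariant under the forward flows of
the fields `ω f₀ + v f₁`. Where `f₀`, `f₁`, `[f₀, f₁]` are independent, three-arc switching already
fills open sets close to the starting point
(`IsBlochInvariant.mem_closure_interior_of_bracketDet_ne_zero`). The determinant cannot vanish on a
nonempty relatively open part of `C`: its iterated `f₁`-derivatives would vanish there too, which
forces `r_y = r_z = 0`, and the drift leaves this line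
(`IsBlochInvariant.exists_bracketDet_ne_zero`). Hence `C ⊆ cl (int C)`.

Reachable sets are invariant, which gives the equality of closures. The set of points steerable to
`p` is invariant for the reversed dynamics, so it has interior points arbitrarily close to `p`. If
`p ∈ int (cl C₊)`, this interior meets `C₊`, and concatenation reaches `p`. -/

/-! ### Concatenation of trajectories -/

/-- Precomposing an absolutely continuous function with a monotone nonexpansive map gives an
absolutely continuous function. -/
theorem AbsolutelyContinuousOnInterval.comp_monotone_lipschitz {X : Type*} [PseudoMetricSpace X]
    {f : ℝ → X} {φ : ℝ → ℝ} {a b c d : ℝ} (hf : AbsolutelyContinuousOnInterval f a b)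
    (hφ : Monotone φ) (hφ' : LipschitzWith 1 φ) (hmaps : ∀ t ∈ uIcc c d, φ t ∈ uIcc a b) :
    AbsolutelyContinuousOnInterval (fun t ↦ f (φ t)) c d := by
  rw [absolutelyContinuousOnInterval_iff] at hf ⊢
  intro ε hε
  obtain ⟨δ, hδ, H⟩ := hf ε hε
  refine ⟨δ, hδ, fun E hE hlen ↦ ?_⟩
  refine H (E.1, fun i ↦ (φ (E.2 i).1, φ (E.2 i).2)) ⟨fun i hi ↦ ?_, ?_⟩ ?_
  · exact ⟨hmaps _ (hE.1 i hi).1, hmaps _ (hE.1 i hi).2⟩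
  · intro i hi j hj hij
    have h := hE.2 hi hj hij
    simp only [Function.onFun, uIoc] at h ⊢
    rw [Set.Ioc_disjoint_Ioc] at h ⊢
    rw [← hφ.map_min, ← hφ.map_max, ← hφ.map_min, ← hφ.map_max, ← hφ.map_min, ← hφ.map_max]
    exact hφ h
  · refine lt_of_le_of_lt (Finset.sum_le_sum fun i _ ↦ ?_) hlen
    simpa using hφ'.dist_le_mul (E.2 i).1 (E.2 i).2

/-- Freezing each piece outside its own time interval writes the glued curve as a sum, so absolute
continuity needs no case split at the junction. -/
theorem IsCoherentTrajectory.trans {ω κ γ T S : ℝ} {u₁ u₂ : ℝ → ℝ} {r₁ r₂ : ℝ → BlochSpace}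
    (hT : 0 ≤ T) (hS : 0 ≤ S) (h₁ : IsCoherentTrajectory ω κ γ T u₁ r₁)
    (h₂ : IsCoherentTrajectory ω κ γ S u₂ r₂) (h : r₁ T = r₂ 0) :
    IsCoherentTrajectory ω κ γ (T + S) (fun t ↦ if t ≤ T then u₁ t else u₂ (t - T))
      (fun t ↦ r₁ (min t T) + (r₂ (max (t - T) 0) - r₂ 0)) := by
  refine ⟨?_, ?_, ?_⟩
  · refine IntervalIntegrable.trans (b := T) ?_ ?_
    · refine h₁.integrable_control.congr fun t ht ↦ ?_
      rw [uIoc_of_le hT] at ht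
      exact (if_pos ht.2).symm
    · have := h₂.integrable_control.comp_sub_right T
      rw [zero_add, add_comm S T] at this
      refine this.congr fun t ht ↦ ?_
      rw [uIoc_of_le (by linarith)] at ht
      exact (if_neg (not_le.2 ht.1)).symm
  · have e₁ : AbsolutelyContinuousOnInterval (fun t ↦ r₁ (min t T)) 0 (T + S) := by
      refine h₁.absolutelyContinuous.comp_monotone_lipschitz (φ := fun t ↦ min t T)
        (fun a b hab ↦ min_le_min_right _ hab) (LipschitzWith.id.min_const T) fun t ht ↦ ?_
      rw [uIcc_of_le (by linarith)] at ht
      rw [uIcc_of_le hT]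
      exact ⟨le_min ht.1 hT, min_le_right _ _⟩
    have e₂ : AbsolutelyContinuousOnInterval (fun t ↦ r₂ (max (t - T) 0)) 0 (T + S) := by
      refine h₂.absolutelyContinuous.comp_monotone_lipschitz (φ := fun t ↦ max (t - T) 0)
        (fun a b hab ↦ max_le_max_right _ (by linarith)) ?_ fun t ht ↦ ?_
      · refine LipschitzWith.max_const (LipschitzWith.of_dist_le_mul fun a b ↦ ?_) 0
        simp
      rw [uIcc_of_le (by linarith)] at ht
      rw [uIcc_of_le hS]
      exact ⟨le_max_right _ _, max_le (by linarith [ht.2]) hS⟩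
    have e₃ : AbsolutelyContinuousOnInterval (fun _ ↦ r₂ 0) 0 (T + S) :=
      ((LipschitzWith.const (r₂ 0)).lipschitzOnWith).absolutelyContinuousOnInterval
    exact e₁.fun_add (e₂.fun_sub e₃)
  · have d₁ := h₁.ae_hasDerivAt
    have d₂ := h₂.ae_hasDerivAt
    rw [ae_restrict_iff' measurableSet_Icc] at d₁ d₂ ⊢
    have d₃ := (measurePreserving_sub_right volume T).quasiMeasurePreserving.ae d₂
    -- The two-sided derivative may fail to exist at the junction, a null set.
    have hne : ∀ x : ℝ, ∀ᵐ t : ℝ, t ≠ x := fun x ↦ by simp [ae_iff]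
    filter_upwards [d₁, d₃, hne T] with t ht₁ ht₂ htT ht
    rcases lt_or_gt_of_ne htT with hlt | hlt
    · have := ht₁ ⟨ht.1, hlt.le⟩
      have hev : (fun t ↦ r₁ (min t T) + (r₂ (max (t - T) 0) - r₂ 0)) =ᶠ[nhds t] r₁ := by
        filter_upwards [eventually_lt_nhds hlt] with s hs
        rw [min_eq_left hs.le, max_eq_right (by linarith), sub_self, add_zero]
      rw [if_pos hlt.le, hev.eq_of_nhds]
      exact this.congr_of_eventuallyEq hev
    · have := (ht₂ ⟨by linarith, by linarith [ht.2]⟩).comp_sub_const t T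
      have hev : (fun t ↦ r₁ (min t T) + (r₂ (max (t - T) 0) - r₂ 0)) =ᶠ[nhds t]
          fun t ↦ r₂ (t - T) := by
        filter_upwards [eventually_gt_nhds hlt] with s hs
        rw [min_eq_right (le_of_lt hs), max_eq_left (by linarith), h]
        abel
      rw [if_neg (not_le.2 hlt), hev.eq_of_nhds]
      exact this.congr_of_eventuallyEq hev

theorem coherentReachableSet_trans {ω κ γ : ℝ} {p q s : BlochSpace}
    (hq : q ∈ coherentReachableSet ω κ γ p) (hs : s ∈ coherentReachableSet ω κ γ q) :
    s ∈ coherentReachableSet ω κ γ p := by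
  obtain ⟨T, u₁, r₁, hT, h₁, h₁0, h₁T⟩ := hq
  obtain ⟨S, u₂, r₂, hS, h₂, h₂0, h₂S⟩ := hs
  refine ⟨T + S, _, _, by linarith, h₁.trans hT hS h₂ (h₁T.trans h₂0.symm), ?_, ?_⟩
  · simp [h₁0, hT]
  · simp [h₁T, h₂0, h₂S, hS]

/-! ### Flows of affine fields through the matrix exponential -/

section AffineFlow

variable {E : Type*} [NormedAddCommGroup E] [NormedSpace ℝ E]

/-- The linear field on `E × ℝ` that induces the affine field `p ↦ A p + b` on `E × {1}`. -/
noncomputable def homogenization (A : E →L[ℝ] E) (b : E) : (E × ℝ) →L[ℝ] (E × ℝ) :=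
  (A.coprod (ContinuousLinearMap.toSpanSingleton ℝ b)).prod 0

/-- The flow of the affine field `p ↦ A p + b`. -/
noncomputable def affineFlow (A : E →L[ℝ] E) (b : E) (t : ℝ) (p : E) : E :=
  (NormedSpace.exp (t • homogenization A b) (p, 1)).1

/-- The linear part of the affine map `affineFlow A b t`. -/
noncomputable def affineFlowLinear (A : E →L[ℝ] E) (b : E) (t : ℝ) : E →L[ℝ] E :=
  (ContinuousLinearMap.fst ℝ E ℝ).comp
    ((NormedSpace.exp (t • homogenization A b)).comp (ContinuousLinearMap.inl ℝ E ℝ))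

variable (A : E →L[ℝ] E) (b : E)

theorem homogenization_apply (z : E × ℝ) : homogenization A b z = (A z.1 + z.2 • b, 0) := by
  simp [homogenization]

@[simp]
theorem affineFlow_zero (p : E) : affineFlow A b 0 p = p := by
  simp [affineFlow]

@[simp]
theorem affineFlowLinear_zero (v : E) : affineFlowLinear A b 0 v = v := by
  simp [affineFlowLinear]

theorem hasFDerivAt_affineFlow (t : ℝ) (p : E) :
    HasFDerivAt (affineFlow A b t) (affineFlowLinear A b t) p := by
  have h : HasFDerivAt (fun p : E ↦ ((p, 1) : E × ℝ)) (ContinuousLinearMap.inl ℝ E ℝ) p := by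
    exact (hasFDerivAt_id p).prodMk (hasFDerivAt_const 1 p)
  exact ((ContinuousLinearMap.fst ℝ E ℝ).hasFDerivAt.comp p
    ((NormedSpace.exp (t • homogenization A b)).hasFDerivAt.comp p h))

theorem affineFlow_neg (t : ℝ) (p : E) : affineFlow (-A) (-b) t p = affineFlow A b (-t) p := by
  have h : homogenization (-A) (-b) = -homogenization A b := by
    ext z <;> simp [homogenization]
  rw [affineFlow, affineFlow, h, smul_neg, ← neg_smul]

variable [CompleteSpace E]

theorem hasDerivAt_exp_homogenization (t : ℝ) (z : E × ℝ) :
    HasDerivAt (fun t : ℝ ↦ NormedSpace.exp (t • homogenization A b) z)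
      (homogenization A b (NormedSpace.exp (t • homogenization A b) z)) t :=
  (hasDerivAt_exp_smul_const' (𝕂 := ℝ) (homogenization A b) t).clm_apply (hasDerivAt_const t z)
    |>.congr_deriv (by simp)

/-- The slices `E × {1}` and `E × {0}` are therefore preserved; they carry the affine flow and its
linear part. -/
theorem exp_homogenization_snd (t : ℝ) (z : E × ℝ) :
    (NormedSpace.exp (t • homogenization A b) z).2 = z.2 := by
  have h (t : ℝ) : HasDerivAt
      (fun t : ℝ ↦ (NormedSpace.exp (t • homogenization A b) z).2) 0 t := by
    have := (hasDerivAt_exp_homogenization A b t z).snd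
    rwa [homogenization_apply] at this
  have := is_const_of_deriv_eq_zero (fun t ↦ (h t).differentiableAt) (fun t ↦ (h t).deriv) t 0
  simpa using this

theorem hasDerivAt_affineFlow (t : ℝ) (p : E) :
    HasDerivAt (fun t ↦ affineFlow A b t p) (A (affineFlow A b t p) + b) t := by
  have := (hasDerivAt_exp_homogenization A b t (p, 1)).fst
  rw [homogenization_apply, exp_homogenization_snd, one_smul] at this
  exact this

theorem hasDerivAt_affineFlowLinear (t : ℝ) (v : E) :
    HasDerivAt (fun t ↦ affineFlowLinear A b t v) (A (affineFlowLinear A b t v)) t := by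
  have := (hasDerivAt_exp_homogenization A b t (v, 0)).fst
  rw [homogenization_apply, exp_homogenization_snd, zero_smul, add_zero] at this
  exact this

theorem affineFlow_add (s t : ℝ) (p : E) :
    affineFlow A b (s + t) p = affineFlow A b s (affineFlow A b t p) := by
  have h : NormedSpace.exp (t • homogenization A b) (p, 1) = (affineFlow A b t p, 1) :=
    Prod.ext rfl (exp_homogenization_snd A b t (p, 1))
  have hc : Commute (s • homogenization A b) (t • homogenization A b) :=
    ((Commute.refl _).smul_left s).smul_right t
  let _ : NormedAlgebra ℚ ((E × ℝ) →L[ℝ] (E × ℝ)) := NormedAlgebra.restrictScalars ℚ ℝ _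
  rw [affineFlow, add_smul, NormedSpace.exp_add_of_commute hc]
  change (NormedSpace.exp (s • homogenization A b)
    (NormedSpace.exp (t • homogenization A b) (p, 1))).1 = _
  rw [h]
  rfl

theorem contDiff_affineFlow : ContDiff ℝ 1 (fun z : ℝ × E ↦ affineFlow A b z.1 z.2) := by
  have h : ContDiff ℝ 1 (NormedSpace.exp : ((E × ℝ) →L[ℝ] (E × ℝ)) → _) :=
    contDiff_iff_contDiffAt.2 fun x ↦ (NormedSpace.exp_analytic (𝕂 := ℝ) x).contDiffAt
  have h' : ContDiff ℝ 1 (fun z : ℝ × E ↦ NormedSpace.exp (z.1 • homogenization A b)) :=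
    h.comp (contDiff_fst.smul contDiff_const)
  exact (h'.clm_apply (contDiff_snd.prodMk contDiff_const)).fst

end AffineFlow

/-! ### Bloch fields and determinants -/

/-- The linear part of the Bloch field with constant control `v`. -/
noncomputable def blochLinear (ω γ v : ℝ) : BlochSpace →L[ℝ] BlochSpace :=
  Matrix.toEuclideanCLM (𝕜 := ℝ) !![-γ / 2, -ω, 0; ω, -γ / 2, -v; 0, v, -γ]

/-- The constant part of the Bloch field. -/
noncomputable def blochConst (γ : ℝ) : BlochSpace := !₂[0, 0, γ]

/-- The field `ω f₀ + v f₁`, written as an affine map. -/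
noncomputable def blochField (ω γ v : ℝ) (q : BlochSpace) : BlochSpace :=
  blochLinear ω γ v q + blochConst γ

/-- The flow of `ω f₀ + v f₁`. -/
noncomputable def blochFlow (ω γ v : ℝ) (t : ℝ) (q : BlochSpace) : BlochSpace :=
  affineFlow (blochLinear ω γ v) (blochConst γ) t q

theorem blochLinear_apply (ω γ v : ℝ) (q : BlochSpace) :
    blochLinear ω γ v q = !₂[-γ / 2 * q 0 - ω * q 1, ω * q 0 - γ / 2 * q 1 - v * q 2,
      v * q 1 - γ * q 2] := by
  ext i
  fin_cases i <;>
    simp [blochLinear, Matrix.ofLp_toEuclideanCLM, Matrix.mulVec, dotProduct, Fin.sum_univ_three] <;>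
    ring

theorem blochField_apply (ω γ v : ℝ) (q : BlochSpace) :
    blochField ω γ v q = !₂[-γ / 2 * q 0 - ω * q 1, ω * q 0 - γ / 2 * q 1 - v * q 2,
      v * q 1 - γ * q 2 + γ] := by
  rw [blochField, blochLinear_apply, blochConst]
  ext i
  fin_cases i <;> simp

theorem hasDerivAt_blochFlow (ω γ v t : ℝ) (q : BlochSpace) :
    HasDerivAt (fun t ↦ blochFlow ω γ v t q) (blochField ω γ v (blochFlow ω γ v t q)) t :=
  hasDerivAt_affineFlow _ _ t q

@[simp]
theorem blochFlow_zero (ω γ v : ℝ) (q : BlochSpace) : blochFlow ω γ v 0 q = q :=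
  affineFlow_zero _ _ q

theorem contDiff_blochFlow (ω γ v : ℝ) :
    ContDiff ℝ 1 (fun z : ℝ × BlochSpace ↦ blochFlow ω γ v z.1 z.2) :=
  contDiff_affineFlow _ _

theorem continuous_blochFlow (ω γ v : ℝ) (q : BlochSpace) :
    Continuous fun t ↦ blochFlow ω γ v t q :=
  continuous_iff_continuousAt.2 fun t ↦ (hasDerivAt_blochFlow ω γ v t q).continuousAt

/-- The determinant of three Bloch vectors. -/
def tripleDet (a b c : BlochSpace) : ℝ :=
  a 0 * (b 1 * c 2 - b 2 * c 1) - a 1 * (b 0 * c 2 - b 2 * c 0) + a 2 * (b 0 * c 1 - b 1 * c 0)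

theorem HasDerivAt.blochSpace_apply {f : ℝ → BlochSpace} {f' : BlochSpace} {t : ℝ}
    (h : HasDerivAt f f' t) (i : Fin 3) : HasDerivAt (fun t ↦ f t i) (f' i) t :=
  (EuclideanSpace.proj (𝕜 := ℝ) i).hasFDerivAt.comp_hasDerivAt t h

theorem HasDerivAt.tripleDet {a b c : ℝ → BlochSpace} {a' b' c' : BlochSpace} {t : ℝ}
    (ha : HasDerivAt a a' t) (hb : HasDerivAt b b' t) (hc : HasDerivAt c c' t) :
    HasDerivAt (fun t ↦ tripleDet (a t) (b t) (c t))
      (tripleDet a' (b t) (c t) + tripleDet (a t) b' (c t) + tripleDet (a t) (b t) c') t := by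
  have a_ := ha.blochSpace_apply
  have b_ := hb.blochSpace_apply
  have c_ := hc.blochSpace_apply
  refine ((((a_ 0).mul (((b_ 1).mul (c_ 2)).sub ((b_ 2).mul (c_ 1)))).sub
    ((a_ 1).mul (((b_ 0).mul (c_ 2)).sub ((b_ 2).mul (c_ 0))))).add
    ((a_ 2).mul (((b_ 0).mul (c_ 1)).sub ((b_ 1).mul (c_ 0))))).congr_deriv ?_
  simp only [_root_.tripleDet, Pi.mul_apply, Pi.sub_apply]
  ring

theorem det_eq_tripleDet (L : BlochSpace →L[ℝ] BlochSpace) :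
    L.det = tripleDet (L (EuclideanSpace.single 0 1)) (L (EuclideanSpace.single 1 1))
      (L (EuclideanSpace.single 2 1)) := by
  rw [ContinuousLinearMap.det,
    ← LinearMap.det_toMatrix (EuclideanSpace.basisFun (Fin 3) ℝ).toBasis, Matrix.det_fin_three]
  simp [LinearMap.toMatrix_apply, tripleDet]
  ring

/-! ### Interior points from the bracket condition -/

/-- The determinant of `ω f₀`, `f₁` and their Lie bracket, divided by `γ`. -/
noncomputable def bracketDet (ω γ : ℝ) (q : BlochSpace) : ℝ :=
  ω * (3 / 2 * q 1 ^ 2 * q 2 - q 1 ^ 2 + q 0 ^ 2 * q 2 / 2 - q 2 ^ 2 + q 2 ^ 3) +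
    γ / 2 * q 0 * q 1 * (q 2 - 1)

/-- A set that is invariant under the forward flows of all fields `ω f₀ + v f₁`. -/
def IsBlochInvariant (ω γ : ℝ) (C : Set BlochSpace) : Prop :=
  ∀ v t, 0 ≤ t → ∀ q ∈ C, blochFlow ω γ v t q ∈ C

/-- Follow the drift for time `s 2`, the field with control `1` for time `s 1` and the drift again
for time `s 0`. -/
noncomputable def switchMap (ω γ : ℝ) (q : BlochSpace) (s : BlochSpace) : BlochSpace :=
  blochFlow ω γ 0 (s 0) (blochFlow ω γ 1 (s 1) (blochFlow ω γ 0 (s 2) q))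

theorem contDiff_switchMap (ω γ : ℝ) (q : BlochSpace) : ContDiff ℝ 1 (switchMap ω γ q) := by
  have hp (i : Fin 3) : ContDiff ℝ 1 (fun s : BlochSpace ↦ s i) :=
    (EuclideanSpace.proj (𝕜 := ℝ) i).contDiff
  have h₁ := (contDiff_blochFlow ω γ 0).comp ((hp 2).prodMk (contDiff_const (c := q)))
  have h₂ := (contDiff_blochFlow ω γ 1).comp ((hp 1).prodMk h₁)
  exact (contDiff_blochFlow ω γ 0).comp ((hp 0).prodMk h₂)

/-- The Jacobian determinant of `switchMap` at `(0, t, 0)`. -/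
theorem det_fderiv_switchMap (ω γ t : ℝ) (q : BlochSpace) :
    (fderiv ℝ (switchMap ω γ q) (EuclideanSpace.single 1 t)).det =
      tripleDet (blochField ω γ 0 (blochFlow ω γ 1 t q)) (blochField ω γ 1 (blochFlow ω γ 1 t q))
        (affineFlowLinear (blochLinear ω γ 1) (blochConst γ) t (blochField ω γ 0 q)) := by
  have hf := ((contDiff_switchMap ω γ q).differentiable one_ne_zero
    (EuclideanSpace.single 1 t)).hasFDerivAt
  have key (i : Fin 3) (τ₀ : ℝ) (c : ℝ → BlochSpace)
      (hc : HasDerivAt c (EuclideanSpace.single i 1) τ₀) (h0 : c τ₀ = EuclideanSpace.single 1 t) :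
      HasDerivAt (fun τ ↦ switchMap ω γ q (c τ))
        (fderiv ℝ (switchMap ω γ q) (EuclideanSpace.single 1 t) (EuclideanSpace.single i 1)) τ₀ := by
    rw [← h0] at hf ⊢
    exact hf.comp_hasDerivAt τ₀ hc
  have hline (i : Fin 3) (b : BlochSpace) (τ₀ : ℝ) : HasDerivAt
      (fun τ : ℝ ↦ b + τ • (EuclideanSpace.single i 1 : BlochSpace))
      (EuclideanSpace.single i 1) τ₀ := by
    simpa using ((hasDerivAt_id τ₀).smul_const (EuclideanSpace.single i 1 : BlochSpace)).const_add b
  rw [det_eq_tripleDet]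
  congr 1
  · have h := key 0 0 _ (hline 0 (EuclideanSpace.single 1 t) 0) (by simp)
    refine h.unique ?_
    have := hasDerivAt_blochFlow ω γ 0 0 (blochFlow ω γ 1 t q)
    simpa [switchMap] using! this
  · have h := key 1 t _ (hline 1 0 t) (by ext i; simp)
    refine h.unique ?_
    have := hasDerivAt_blochFlow ω γ 1 t q
    simpa [switchMap] using! this
  · have h := key 2 0 _ (hline 2 (EuclideanSpace.single 1 t) 0) (by simp)
    refine h.unique ?_
    have h₁ := hasDerivAt_blochFlow ω γ 0 0 q
    rw [blochFlow_zero] at h₁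
    have h₂ := hasFDerivAt_affineFlow (blochLinear ω γ 1) (blochConst γ) t (blochFlow ω γ 0 0 q)
    have := h₂.comp_hasDerivAt (0 : ℝ) h₁
    simpa [switchMap, Function.comp_def, blochFlow] using! this

/-- At `t = 0` the first and third columns coincide, so the Jacobian vanishes there; the bracket
appears in its first derivative. -/
theorem hasDerivAt_jacobian_switchMap (ω γ : ℝ) (q : BlochSpace) :
    HasDerivAt (fun t ↦ tripleDet (blochField ω γ 0 (blochFlow ω γ 1 t q))
      (blochField ω γ 1 (blochFlow ω γ 1 t q))
        (affineFlowLinear (blochLinear ω γ 1) (blochConst γ) t (blochField ω γ 0 q)))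
      (γ * bracketDet ω γ q) 0 := by
  have h₁ (v : ℝ) := ((blochLinear ω γ v).hasFDerivAt.comp_hasDerivAt (0 : ℝ)
    (hasDerivAt_blochFlow ω γ 1 0 q)).add_const (blochConst γ)
  have h₂ := hasDerivAt_affineFlowLinear (blochLinear ω γ 1) (blochConst γ) 0 (blochField ω γ 0 q)
  refine ((h₁ 0).tripleDet (h₁ 1) h₂).congr_deriv ?_
  simp only [blochFlow_zero, affineFlowLinear_zero, Function.comp_apply]
  simp only [blochConst, blochField_apply, blochLinear_apply, tripleDet, bracketDet]
  simp
  ring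

/-- The Jacobian of `switchMap` is nonzero at `(0, t, 0)` for small `t > 0`, so the inverse function
theorem produces open sets of reached points near `q`. -/
theorem IsBlochInvariant.mem_closure_interior_of_bracketDet_ne_zero {ω γ : ℝ}
    {C : Set BlochSpace} (hC : IsBlochInvariant ω γ C) (hγ : γ ≠ 0) {q : BlochSpace} (hq : q ∈ C)
    (hd : bracketDet ω γ q ≠ 0) : q ∈ closure (interior C) := by
  rw [mem_closure_iff_nhds]
  intro U hU
  wlog hUo : IsOpen U generalizing U
  · obtain ⟨V, hVU, hV, hqV⟩ := mem_nhds_iff.1 hU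
    exact (this V (hV.mem_nhds hqV) hV).mono (inter_subset_inter_left _ hVU)
  have hψ := contDiff_switchMap ω γ q
  let W : Set BlochSpace := switchMap ω γ q ⁻¹' U ∩ {s | (fderiv ℝ (switchMap ω γ q) s).det ≠ 0}
  have hW : IsOpen W :=
    (hUo.preimage hψ.continuous).inter (isOpen_ne.preimage
      (ContinuousLinearMap.continuous_det.comp (hψ.continuous_fderiv one_ne_zero)))
  obtain ⟨t, ⟨htU, htd⟩, ht⟩ : ∃ t : ℝ, (blochFlow ω γ 1 t q ∈ U ∧
      (fderiv ℝ (switchMap ω γ q) (EuclideanSpace.single 1 t)).det ≠ 0) ∧ 0 < t := by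
    have e₁ := (hasDerivAt_jacobian_switchMap ω γ q).eventually_ne
      (mul_ne_zero hγ hd) (c := 0)
    have e₂ : ∀ᶠ t in nhds (0 : ℝ), blochFlow ω γ 1 t q ∈ U :=
      (continuous_blochFlow ω γ 1 q).continuousAt.eventually_mem (by simpa using hU)
    have e₃ : ∀ᶠ t : ℝ in nhdsWithin 0 (Ioi 0), 0 < t := eventually_mem_nhdsWithin
    have hsub : Ioi (0 : ℝ) ⊆ {0}ᶜ := fun t ht ↦ (mem_Ioi.1 ht).ne'
    obtain ⟨t, h₁, h₂, h₃⟩ := ((e₁.filter_mono (nhdsWithin_mono 0 hsub)).and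
      ((e₂.filter_mono nhdsWithin_le_nhds).and e₃)).exists
    exact ⟨t, ⟨h₂, by rwa [det_fderiv_switchMap]⟩, h₃⟩
  -- The outer times are moved from `0` to a small `ε > 0`, so that a whole neighbourhood of `s`
  -- consists of admissible, nonnegative times.
  obtain ⟨s, ⟨hsU, hsd⟩, hs⟩ : ∃ s ∈ W, ∀ i, 0 < s i := by
    let c : ℝ → BlochSpace := fun ε ↦ !₂[ε, t, ε]
    have hc : Continuous c := by fun_prop
    have hc0 : c 0 ∈ W := by
      have : c 0 = EuclideanSpace.single 1 t := by
        ext i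
        fin_cases i <;> simp [c]
      rw [this]
      exact ⟨by simpa [switchMap] using htU, htd⟩
    have e₁ : ∀ᶠ ε in nhds (0 : ℝ), c ε ∈ W := hc.continuousAt.eventually_mem (hW.mem_nhds hc0)
    have e₃ : ∀ᶠ t : ℝ in nhdsWithin 0 (Ioi 0), 0 < t := eventually_mem_nhdsWithin
    obtain ⟨ε, h₁, h₂⟩ := ((e₁.filter_mono nhdsWithin_le_nhds).and e₃).exists
    refine ⟨c ε, h₁, fun i ↦ ?_⟩
    fin_cases i <;> simp [c, ht, h₂]
  refine ⟨switchMap ω γ q s, hsU, ?_⟩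
  have hst : HasStrictFDerivAt (switchMap ω γ q)
      (((fderiv ℝ (switchMap ω γ q) s).toContinuousLinearEquivOfDetNeZero hsd :
        BlochSpace ≃L[ℝ] BlochSpace) : BlochSpace →L[ℝ] BlochSpace) s := by
    rw [ContinuousLinearMap.coe_toContinuousLinearEquivOfDetNeZero]
    exact hψ.contDiffAt.hasStrictFDerivAt one_ne_zero
  rw [mem_interior_iff_mem_nhds, ← hst.map_nhds_eq_of_equiv, Filter.mem_map]
  have hpos : ∀ᶠ x : BlochSpace in nhds s, ∀ i, 0 < x i := by
    rw [Filter.eventually_all]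
    intro i
    exact (EuclideanSpace.proj (𝕜 := ℝ) i).continuous.continuousAt.eventually_const_lt (hs i)
  filter_upwards [hpos] with x hx
  exact hC _ _ (hx 0).le _ (hC _ _ (hx 1).le _ (hC _ _ (hx 2).le _ hq))

/-- The flow stays in `C ∩ U` for small `t ≥ 0` only, but a one-sided derivative already determines
`d`. -/
theorem IsBlochInvariant.hasDerivAt_eq_zero {ω γ : ℝ} {C U : Set BlochSpace}
    (hC : IsBlochInvariant ω γ C) (hU : IsOpen U) {h : BlochSpace → ℝ}
    (hz : ∀ q ∈ C ∩ U, h q = 0) {q : BlochSpace} (hq : q ∈ C ∩ U) {v d : ℝ}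
    (hd : HasDerivAt (fun t ↦ h (blochFlow ω γ v t q)) d 0) : d = 0 := by
  refine UniqueDiffWithinAt.eq_deriv _ (uniqueDiffWithinAt_Ici 0) hd.hasDerivWithinAt ?_
  refine (hasDerivWithinAt_const (0 : ℝ) (Ici 0) (0 : ℝ)).congr_of_eventuallyEq ?_
    (by simpa using hz q hq)
  have e₂ : ∀ᶠ t in nhds (0 : ℝ), blochFlow ω γ v t q ∈ U :=
    (continuous_blochFlow ω γ v q).continuousAt.eventually_mem
      (by simpa using hU.mem_nhds hq.2)
  filter_upwards [e₂.filter_mono nhdsWithin_le_nhds, eventually_mem_nhdsWithin] with t h₁ h₂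
  exact hz _ ⟨hC v t h₂ q hq.1, h₁⟩

/-! ### Derivatives of the determinant along the control rotation -/

/-- A family of polynomials that is invariant under differentiation along `f₁`. -/
def rotationPolynomial (a b b' c c' d d' e e' f f' : ℝ) (q : BlochSpace) : ℝ :=
  a * (q 1 ^ 2 + q 2 ^ 2) + (q 1 ^ 2 + q 2 ^ 2) * (b * q 2 + b' * q 1)
    + q 0 ^ 2 * (c * q 2 + c' * q 1) + q 0 * (d * q 1 + d' * q 2)
    + q 0 * (e * (q 1 * q 2) + e' * (q 1 ^ 2 - q 2 ^ 2))
    + f * (3 * q 1 ^ 2 * q 2 - q 2 ^ 3) + f' * (q 1 ^ 3 - 3 * q 1 * q 2 ^ 2)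

/-- `L` is the differential at `q`. Additivity allows the `f₁`-derivative to be recovered as a
difference of derivatives along two admissible fields. -/
theorem exists_hasDerivAt_rotationPolynomial (a b b' c c' d d' e e' f f' : ℝ) (q : BlochSpace) :
    ∃ L : BlochSpace → ℝ, (∀ x y, L (x - y) = L x - L y) ∧
      L (controlField q) =
        rotationPolynomial 0 (-b') b (-c') c d' (-d) (-4 * e') e (-3 * f') (3 * f) q ∧
      ∀ (r : ℝ → BlochSpace) (r' : BlochSpace), HasDerivAt r r' 0 → r 0 = q →
        HasDerivAt (fun t ↦ rotationPolynomial a b b' c c' d d' e e' f f' (r t)) (L r') 0 := by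
  refine ⟨fun r' ↦ a * (2 * q 1 * r' 1 + 2 * q 2 * r' 2)
    + ((2 * q 1 * r' 1 + 2 * q 2 * r' 2) * (b * q 2 + b' * q 1)
      + (q 1 ^ 2 + q 2 ^ 2) * (b * r' 2 + b' * r' 1))
    + (2 * q 0 * r' 0 * (c * q 2 + c' * q 1) + q 0 ^ 2 * (c * r' 2 + c' * r' 1))
    + (r' 0 * (d * q 1 + d' * q 2) + q 0 * (d * r' 1 + d' * r' 2))
    + (r' 0 * (e * (q 1 * q 2) + e' * (q 1 ^ 2 - q 2 ^ 2))
      + q 0 * (e * (r' 1 * q 2 + q 1 * r' 2) + e' * (2 * q 1 * r' 1 - 2 * q 2 * r' 2)))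
    + f * (3 * (2 * q 1 * r' 1) * q 2 + 3 * q 1 ^ 2 * r' 2 - 3 * q 2 ^ 2 * r' 2)
    + f' * (3 * q 1 ^ 2 * r' 1 - (3 * r' 1 * q 2 ^ 2 + 3 * q 1 * (2 * q 2 * r' 2))),
    fun x y ↦ ?_, ?_, fun r r' hr h0 ↦ ?_⟩
  · simp only [PiLp.sub_apply]
    ring
  · simp [controlField, rotationPolynomial]
    ring
  · have x := hr.blochSpace_apply 0
    have y := hr.blochSpace_apply 1
    have z := hr.blochSpace_apply 2
    have s := ((y.pow 2).add (z.pow 2))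
    refine (((((((s.const_mul a).add (s.mul ((z.const_mul b).add (y.const_mul b')))).add
      ((x.pow 2).mul ((z.const_mul c).add (y.const_mul c')))).add
      (x.mul ((y.const_mul d).add (z.const_mul d')))).add
      (x.mul (((y.mul z).const_mul e).add (((y.pow 2).sub (z.pow 2)).const_mul e')))).add
      (((((y.pow 2).const_mul 3).mul z).sub (z.pow 3)).const_mul f)).add
      (((y.pow 3).sub ((y.const_mul 3).mul (z.pow 2))).const_mul f')).congr_deriv ?_
    simp only [Pi.add_apply, Pi.mul_apply, Pi.sub_apply, Pi.pow_apply, h0]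
    norm_num

theorem blochField_one_sub_blochField_zero (ω γ : ℝ) (q : BlochSpace) :
    blochField ω γ 1 q - blochField ω γ 0 q = controlField q := by
  rw [blochField_apply, blochField_apply, controlField]
  ext i
  fin_cases i <;> simp

theorem IsBlochInvariant.rotationPolynomial_eq_zero {ω γ : ℝ} {C U : Set BlochSpace}
    (hC : IsBlochInvariant ω γ C) (hU : IsOpen U) {a b b' c c' d d' e e' f f' : ℝ}
    (hz : ∀ q ∈ C ∩ U, rotationPolynomial a b b' c c' d d' e e' f f' q = 0) :
    ∀ q ∈ C ∩ U,
      rotationPolynomial 0 (-b') b (-c') c d' (-d) (-4 * e') e (-3 * f') (3 * f) q = 0 := by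
  intro q hq
  obtain ⟨L, hsub, hL, hd⟩ := exists_hasDerivAt_rotationPolynomial a b b' c c' d d' e e' f f' q
  have h (v : ℝ) : L (blochField ω γ v q) = 0 :=
    hC.hasDerivAt_eq_zero hU hz hq
      (hd _ _ (by simpa using hasDerivAt_blochFlow ω γ v 0 q) (blochFlow_zero _ _ _ _))
  rw [← hL, ← blochField_one_sub_blochField_zero ω γ, hsub, h, h, sub_zero]

theorem bracketDet_eq_rotationPolynomial (ω γ : ℝ) (q : BlochSpace) :
    bracketDet ω γ q =
      rotationPolynomial (-ω) (9 / 8 * ω) 0 (ω / 2) 0 (-γ / 2) 0 (γ / 2) 0 (ω / 8) 0 q := by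
  rw [bracketDet, rotationPolynomial]
  ring

/-- The functions `f₁ᵏ (det (f₀, f₁, [f₀, f₁]))` have no common zero in an open part of a forward
invariant set. -/
theorem IsBlochInvariant.exists_bracketDet_ne_zero {ω γ : ℝ} {C U : Set BlochSpace}
    (hC : IsBlochInvariant ω γ C) (hω : ω ≠ 0) (hγ : γ ≠ 0) (hU : IsOpen U)
    (hne : (C ∩ U).Nonempty) : ∃ q ∈ C ∩ U, bracketDet ω γ q ≠ 0 := by
  by_contra! hz
  have h₀ : ∀ q ∈ C ∩ U, rotationPolynomial (-ω) (9 / 8 * ω) 0 (ω / 2) 0 (-γ / 2) 0 (γ / 2) 0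
      (ω / 8) 0 q = 0 := fun q hq ↦ by rw [← bracketDet_eq_rotationPolynomial, hz q hq]
  have h₂ := hC.rotationPolynomial_eq_zero hU (hC.rotationPolynomial_eq_zero hU h₀)
  have h₄ := hC.rotationPolynomial_eq_zero hU (hC.rotationPolynomial_eq_zero hU h₂)
  have h₆ := hC.rotationPolynomial_eq_zero hU (hC.rotationPolynomial_eq_zero hU h₄)
  have hρ : ∀ q ∈ C ∩ U, q 1 ^ 2 + q 2 ^ 2 = 0 := by
    intro q hq
    have e₀ := h₀ q hq
    have e₂ := h₂ q hq
    have e₄ := h₄ q hq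
    have e₆ := h₆ q hq
    simp only [rotationPolynomial] at e₀ e₂ e₄ e₆
    -- With `D` the derivative along the rotation `f₁`, the coefficients are those of `(D² + 1)(D² +
    -- 4)(D² + 9)`. This operator kills the harmonics of frequency 1, 2 and 3 and multiplies the
    -- rotation-invariant part `-ω (r_y² + r_z²)` by 36.
    have : -36 * ω * (q 1 ^ 2 + q 2 ^ 2) = 0 := by
      linear_combination 36 * e₀ + 49 * e₂ + 14 * e₄ + e₆
    exact (mul_eq_zero.1 this).resolve_left (mul_ne_zero (by norm_num) hω)
  have hz0 : ∀ q ∈ C ∩ U, q 2 = 0 := fun q hq ↦ by nlinarith [hρ q hq]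
  obtain ⟨q, hq⟩ := hne
  -- On `r_y = r_z = 0` the drift moves `r_z` at rate `γ`, a contradiction.
  have hd := hC.hasDerivAt_eq_zero hU hz0 hq (v := 0)
    ((hasDerivAt_blochFlow ω γ 0 0 q).blochSpace_apply 2)
  simp [blochField_apply, hz0 q hq] at hd
  exact hγ hd

theorem IsBlochInvariant.subset_closure_interior {ω γ : ℝ} {C : Set BlochSpace}
    (hC : IsBlochInvariant ω γ C) (hω : ω ≠ 0) (hγ : γ ≠ 0) : C ⊆ closure (interior C) := by
  intro p hp
  rw [mem_closure_iff]
  intro U hU hpU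
  obtain ⟨q, ⟨hqC, hqU⟩, hq⟩ := hC.exists_bracketDet_ne_zero hω hγ hU ⟨p, hp, hpU⟩
  exact mem_closure_iff.1 (hC.mem_closure_interior_of_bracketDet_ne_zero hγ hqC hq) U hU hqU

/-! ### Forward and backward reachable sets -/

theorem blochField_eq {ω κ γ : ℝ} (hω : ω ≠ 0) (u : ℝ) (q : BlochSpace) :
    ω • driftField ω γ q + (2 * κ * u) • controlField q = blochField ω γ (2 * κ * u) q := by
  rw [blochField_apply, driftField, controlField]
  ext i
  fin_cases i <;> simp <;> field_simp <;> ring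

theorem blochFlow_mem_coherentReachableSet {ω κ γ v t : ℝ} (hω : ω ≠ 0) (hκ : κ ≠ 0) (ht : 0 ≤ t)
    (q : BlochSpace) : blochFlow ω γ v t q ∈ coherentReachableSet ω κ γ q := by
  refine ⟨t, fun _ ↦ v / (2 * κ), fun s ↦ blochFlow ω γ v s q, ht, ⟨?_, ?_, ?_⟩, by simp, rfl⟩
  · exact intervalIntegrable_const
  · refine ContDiffOn.absolutelyContinuousOnInterval (ContDiff.contDiffOn ?_)
    exact (contDiff_blochFlow ω γ v).comp (contDiff_id.prodMk (contDiff_const (c := q)))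
  · refine Filter.Eventually.of_forall fun s ↦ ?_
    rw [blochField_eq hω, mul_div_cancel₀ v (by simpa using hκ)]
    exact hasDerivAt_blochFlow ω γ v s q

theorem self_mem_coherentReachableSet {ω κ γ : ℝ} (hω : ω ≠ 0) (hκ : κ ≠ 0) (q : BlochSpace) :
    q ∈ coherentReachableSet ω κ γ q := by
  simpa using blochFlow_mem_coherentReachableSet (γ := γ) (v := 0) hω hκ le_rfl q

/-- Time reversal stays in the same family, with the signs of `ω`, `γ` and `v` flipped; hence the
invariance lemmas assume only `ω, γ ≠ 0`. -/
theorem blochFlow_neg_right_inverse (ω γ v t : ℝ) (q : BlochSpace) :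
    blochFlow ω γ (-v) t (blochFlow (-ω) (-γ) v t q) = q := by
  have hA : blochLinear (-ω) (-γ) v = -blochLinear ω γ (-v) := by
    ext q i
    fin_cases i <;> simp [blochLinear_apply] <;> ring
  have hb : blochConst (-γ) = -blochConst γ := by
    ext i
    fin_cases i <;> simp [blochConst]
  rw [blochFlow, blochFlow, hA, hb, affineFlow_neg, ← affineFlow_add, add_neg_cancel,
    affineFlow_zero]

theorem isBlochInvariant_coherentReachableSet {ω κ γ : ℝ} (hω : ω ≠ 0) (hκ : κ ≠ 0)
    (p : BlochSpace) : IsBlochInvariant ω γ (coherentReachableSet ω κ γ p) :=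
  fun _ _ ht q hq ↦ coherentReachableSet_trans hq (blochFlow_mem_coherentReachableSet hω hκ ht q)

/-- The set of points that can be steered to `p` is invariant under the reversed dynamics. -/
theorem isBlochInvariant_setOf_mem_coherentReachableSet {ω κ γ : ℝ} (hω : ω ≠ 0) (hκ : κ ≠ 0)
    (p : BlochSpace) :
    IsBlochInvariant (-ω) (-γ) {q | p ∈ coherentReachableSet ω κ γ q} := by
  intro v t ht q hq
  refine coherentReachableSet_trans ?_ hq
  have := blochFlow_mem_coherentReachableSet (γ := γ) (v := -v) hω hκ ht
    (blochFlow (-ω) (-γ) v t q)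
  rwa [blochFlow_neg_right_inverse] at this

theorem interior_closure_coherentReachableSet_subset {ω κ γ : ℝ} (hω : ω ≠ 0) (hκ : κ ≠ 0)
    (hγ : γ ≠ 0) (r₀ : BlochSpace) :
    interior (closure (coherentReachableSet ω κ γ r₀)) ⊆ coherentReachableSet ω κ γ r₀ := by
  intro p hp
  have hback := (isBlochInvariant_setOf_mem_coherentReachableSet (γ := γ) hω hκ
    p).subset_closure_interior (neg_ne_zero.2 hω) (neg_ne_zero.2 hγ)
    (self_mem_coherentReachableSet hω hκ p)
  -- `q` is interior to the set steerable to `p` and lies in the closure of the reachable set, so a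
  -- reachable `s` near `q` can still be steered to `p`.
  obtain ⟨q, hq, hq'⟩ := mem_closure_iff.1 hback _ isOpen_interior hp
  obtain ⟨s, hs, hs'⟩ := mem_closure_iff.1 (interior_subset hq) _ isOpen_interior hq'
  have hs'' : s ∈ {q | p ∈ coherentReachableSet ω κ γ q} := interior_subset hs
  exact coherentReachableSet_trans hs' hs''

theorem theorem2 (ω κ γ : ℝ) (hω : 0 < ω) (hκ : 0 < κ) (hγ : 0 < γ) (r₀ : BlochSpace) :
    interior (closure (coherentReachableSet ω κ γ r₀)) ⊆ coherentReachableSet ω κ γ r₀ ∧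
    coherentReachableSet ω κ γ r₀ ⊆ closure (coherentReachableSet ω κ γ r₀) ∧
    closure (coherentReachableSet ω κ γ r₀) =
      closure (interior (coherentReachableSet ω κ γ r₀)) := by
  refine ⟨interior_closure_coherentReachableSet_subset hω.ne' hκ.ne' hγ.ne' r₀, subset_closure,
    Subset.antisymm (closure_minimal ?_ isClosed_closure) (closure_mono interior_subset)⟩
  exact (isBlochInvariant_coherentReachableSet hω.ne' hκ.ne' r₀).subset_closure_interior
    hω.ne' hγ.ne'
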